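/- All graphs are finite and simple. A graph is 2-connected if it has at least three vertices, is connected, and remains connected after the deletion of any one vertex. A double-star is a tree with exactly two vertices of degree greater than one (its centers, which are adjacent). Let $r,m$ be integers with $1\le r\le m-4$ and let $S$ be any double-star with $m-r$ vertices. Let $PDS1(r,m-r)$ (respectively $PDS2(r,m-r)$) be the tree with $m$ vertices obtained from the disjoint union of $S$ and a path with $r+1$ vertices by identifying one end vertex of the path with a vertex of degree one of $S$ that is adjacent to the center of $S$ with the larger (respectively smaller) degree; if both centers have the same degree, the two trees are isomorphic. Theorem. Every 2-connected graph $G$ with minimum degree $\delta(G)\ge m+2$ contains a subgraph $T$ such that $T$ is isomorphic to $PDS1(r,m-r)$ or to $PDS2(r,m-r)$ and such that $G-V(T)$ is 2-connected. -/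

import Mathlib

namespace PathDoubleStar

/-- A finite graph is `k`-connected if it has more than `k` vertices and it stays connected
after the deletion of any set of fewer than `k` vertices. -/
def IsKConnected (k : ℕ) {V : Type*} [Finite V] (G : SimpleGraph V) : Prop :=
  k < Nat.card V ∧
    ∀ X : Finset V, X.card < k → (G.induce ((X : Set V)ᶜ)).Connected

/-- A double-star is a tree with exactly two vertices of degree greater than one. -/
def IsDoubleStar {W : Type*} [Fintype W] (S : SimpleGraph W) [DecidableRel S.Adj] : Prop :=
  S.IsTree ∧ (Finset.univ.filter (fun w : W => 1 < S.degree w)).card = 2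

/-- The graph obtained from the disjoint union of `S` and a path with `r + 1` vertices by
identifying one end vertex of the path with the vertex `x` of `S`. The other `r` vertices of the
path are the new vertices `Sum.inr 0, …, Sum.inr (r - 1)`, in this order along the path, so that
the path is `Sum.inl x, Sum.inr 0, …, Sum.inr (r - 1)`. -/
def attachPath {W : Type*} (S : SimpleGraph W) (x : W) (r : ℕ) : SimpleGraph (W ⊕ Fin r) where
  Adj p q :=
    match p, q with
    | Sum.inl a, Sum.inl b => S.Adj a b
    | Sum.inl a, Sum.inr j => a = x ∧ j.val = 0
    | Sum.inr i, Sum.inl b => b = x ∧ i.val = 0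
    | Sum.inr i, Sum.inr j => i.val + 1 = j.val ∨ j.val + 1 = i.val
  symm := ⟨by
    rintro (a | i) (b | j) h
    · exact SimpleGraph.Adj.symm h
    · exact h
    · exact h
    · exact h.symm⟩
  loopless := ⟨by
    rintro (a | i) h
    · exact S.irrefl h
    · simp at h⟩

/-- `H` is the path-double-star of the first kind built from the double-star `S` and a path with
`r + 1` vertices: the path is glued at a pendant vertex `x` adjacent to a vertex `c` of maximum
degree in `S`. -/
def IsPDS1 {W U : Type*} [Fintype W] (S : SimpleGraph W) [DecidableRel S.Adj] (r : ℕ)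
    (H : SimpleGraph U) : Prop :=
  ∃ c x : W, (∀ w, S.degree w ≤ S.degree c) ∧
    S.degree x = 1 ∧ S.Adj c x ∧ Nonempty (H ≃g attachPath S x r)

/-- `H` is the path-double-star of the second kind built from the double-star `S` and a path with
`r + 1` vertices: the path is glued at a pendant vertex `x` adjacent to the vertex `c` with the
second largest degree in `S` (after a vertex `c'` of maximum degree). -/
def IsPDS2 {W U : Type*} [Fintype W] (S : SimpleGraph W) [DecidableRel S.Adj] (r : ℕ)
    (H : SimpleGraph U) : Prop :=
  ∃ c' c x : W, c ≠ c' ∧ (∀ w, S.degree w ≤ S.degree c') ∧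
    (∀ w, w ≠ c' → S.degree w ≤ S.degree c) ∧
    S.degree x = 1 ∧ S.Adj c x ∧ Nonempty (H ≃g attachPath S x r)

end PathDoubleStar

/-! Among the vertex sets `B` with at least two elements that induce an edge or a 2-connected graph
(`IsRobust`) and whose complement still contains the tree, take a largest one. If the tree fills the
complement of `B`, the theorem holds. Otherwise `B` can be enlarged, in one of two ways.

If no outside vertex has two neighbours in `B`, add a shortest ear. Minimality leaves every
remaining vertex with at least `m - 1` neighbours off `B` and the ear, so a greedy embedding finds a
new copy (`exists_ear_of_card_neighbors_le_one`, `hasCopyIn_of_minDegree`).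

If the set `U` of outside vertices with two neighbours in `B` is nonempty, adding any one of them to
`B` keeps it robust. The difficulty is to find one whose removal leaves a copy outside, and
rerouting the pendant path through unused vertices does this (`exists_hasCopyIn_erase`).

All embeddings rest on `hasCopyIn_of_path`: a path on `r + 3` vertices is enough once its first two
vertices, the future centers, have large degree. The embedding ignores which center has more leaves,
so the first kind of tree is always obtained. -/

namespace PathDoubleStar

open SimpleGraph

/-! ### Structure of double-stars. -/

section DoubleStar

variable {W : Type*}

/-- The shape of a double-star used to embed it: `c` and `c'` are its adjacent centers, `x` and `y`
are pendant vertices at `c` and `c'`. -/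
structure IsFrame (S : SimpleGraph W) (c c' x y : W) : Prop where
  adj_centers : S.Adj c c'
  adj_x : S.Adj c x
  adj_y : S.Adj c' y
  x_ne : x ≠ c'
  y_ne : y ≠ c
  center_of_adj : ∀ {a b}, S.Adj a b → a = c ∨ a = c' ∨ b = c ∨ b = c'
  eq_of_adj : ∀ {w a b}, w ≠ c → w ≠ c' → S.Adj w a → S.Adj w b → a = b

theorem mem_of_connected_of_closed {S : SimpleGraph W} (hS : S.Connected) (A : Set W)
    (hA : ∀ a b, a ∈ A → S.Adj a b → b ∈ A) {a : W} (ha : a ∈ A) (b : W) : b ∈ A := by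
  obtain ⟨p⟩ := hS.preconnected a b
  induction p with
  | nil => exact ha
  | cons h _ ih => exact ih (hA _ _ ha h)

/-- Connectivity forces the shape: an edge missing both centers would be a whole component, and if
the centers were not adjacent, one of them with its neighbours would be. Naming the center of larger
degree `c` makes the tree one of the first kind. -/
theorem exists_frame [Fintype W] (S : SimpleGraph W) [DecidableRel S.Adj] (hS : IsDoubleStar S) :
    ∃ c c' x y, IsFrame S c c' x y ∧ (∀ w, S.degree w ≤ S.degree c) ∧ S.degree x = 1 := by
  classical
  obtain ⟨hT, h2⟩ := hS
  have hconn := hT.connected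
  obtain ⟨d, d', hdd, hF⟩ := Finset.card_eq_two.1 h2
  have hmem : ∀ w, 1 < S.degree w ↔ w = d ∨ w = d' := by
    intro w
    have := congrArg (w ∈ ·) hF
    simpa using this
  obtain ⟨c, c', hcc, hmem, hle⟩ : ∃ c c', c ≠ c' ∧ (∀ w, 1 < S.degree w ↔ w = c ∨ w = c') ∧
      S.degree c' ≤ S.degree c := by
    rcases le_total (S.degree d') (S.degree d) with h | h
    · exact ⟨d, d', hdd, hmem, h⟩
    · exact ⟨d', d, hdd.symm, fun w => (hmem w).trans or_comm, h⟩
  have hdc : 1 < S.degree c := (hmem c).2 (Or.inl rfl)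
  have hdc' : 1 < S.degree c' := (hmem c').2 (Or.inr rfl)
  have huniq : ∀ {w a b}, w ≠ c → w ≠ c' → S.Adj w a → S.Adj w b → a = b := by
    intro w a b h1 h2 ha hb
    have hd : S.degree w ≤ 1 := by
      by_contra h
      rcases (hmem w).1 (not_le.1 h) with h | h
      · exact h1 h
      · exact h2 h
    exact Finset.card_le_one.1 hd a (by simpa using ha) b (by simpa using hb)
  have hcenter : ∀ {a b}, S.Adj a b → a = c ∨ a = c' ∨ b = c ∨ b = c' := by
    intro a b hab
    by_contra! h
    obtain ⟨h1, h2, h3, h4⟩ := h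
    have := mem_of_connected_of_closed hconn ({a, b} : Set W) (by
      rintro u v (rfl | rfl) huv
      · exact Or.inr (huniq h1 h2 huv hab)
      · exact Or.inl (huniq h3 h4 huv hab.symm)) (Or.inl rfl) c
    rcases this with h | h
    · exact h1 h.symm
    · exact h3 h.symm
  have hadj : S.Adj c c' := by
    by_contra hn
    have := mem_of_connected_of_closed hconn ({w | w = c ∨ S.Adj c w} : Set W) (by
      rintro u v (rfl | hu) huv
      · exact Or.inr huv
      · refine Or.inl (huniq hu.ne' ?_ huv hu.symm)
        rintro rfl
        exact hn hu) (Or.inl rfl) c'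
    rcases this with h | h
    · exact hcc h.symm
    · exact hn h
  obtain ⟨x, hx, hxc'⟩ := Finset.exists_mem_ne (s := S.neighborFinset c) (by simpa using hdc) c'
  obtain ⟨y, hy, hyc⟩ := Finset.exists_mem_ne (s := S.neighborFinset c') (by simpa using hdc') c
  rw [mem_neighborFinset] at hx hy
  refine ⟨c, c', x, y, ⟨hadj, hx, hy, hxc', hyc, hcenter, huniq⟩, ?_, ?_⟩
  · intro w
    by_cases h : 1 < S.degree w
    · rcases (hmem w).1 h with rfl | rfl
      · exact le_rfl
      · exact hle
    · omega
  · have h1 : ¬ 1 < S.degree x := by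
      rw [hmem]
      rintro (h | h)
      · exact hx.ne h.symm
      · exact hxc' h
    have h2 : 0 < S.degree x := by
      rw [degree_pos_iff_exists_adj]
      exact ⟨c, hx.symm⟩
    omega

end DoubleStar

/-! ### Longest paths, as lists. -/

section Lists

variable {V : Type*}

theorem exists_maximal_path_list (G : SimpleGraph V) (C : Finset V) (hC : C.Nonempty) :
    ∃ ws : List V, ws.IsChain G.Adj ∧ ws.Nodup ∧ (∀ v ∈ ws, v ∈ C) ∧
      ∃ hne : ws ≠ [], (∀ v ∈ C, G.Adj (ws.head hne) v → v ∈ ws) ∧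
        (∀ v ∈ C, G.Adj (ws.getLast hne) v → v ∈ ws) := by
  classical
  let P : ℕ → Prop := fun n => ∃ ws : List V, ws.IsChain G.Adj ∧ ws.Nodup ∧ (∀ v ∈ ws, v ∈ C) ∧
    ws.length = n
  have hb : ∀ n, P n → n ≤ C.card := by
    rintro n ⟨ws, -, hnd, hs, rfl⟩
    rw [← List.toFinset_card_of_nodup hnd]
    exact Finset.card_le_card fun v hv => hs v (by simpa using hv)
  obtain ⟨v0, hv0⟩ := hC
  have h1 : P 1 := ⟨[v0], by simp, by simp, by simpa using hv0, rfl⟩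
  obtain ⟨ws, hch, hnd, hs, hlen⟩ := Nat.findGreatest_spec (P := P) (hb 1 h1) h1
  have hmax : ∀ n, P n → n ≤ ws.length := fun n hn => by
    rw [hlen]; exact Nat.le_findGreatest (hb n hn) hn
  have hne : ws ≠ [] := by
    have := hmax 1 h1
    rintro rfl
    simp at this
  refine ⟨ws, hch, hnd, hs, hne, ?_, ?_⟩
  · intro v hv hadj
    by_contra hvw
    have := hmax (ws.length + 1) ⟨v :: ws, by
      rw [List.isChain_cons]
      refine ⟨?_, hch⟩
      intro y hy
      rw [List.head?_eq_some_head hne] at hy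
      cases hy
      exact hadj.symm, List.nodup_cons.2 ⟨hvw, hnd⟩, by simpa using ⟨hv, hs⟩, rfl⟩
    omega
  · intro v hv hadj
    by_contra hvw
    have := hmax (ws.length + 1) ⟨ws ++ [v], by
      refine hch.append (by simp) ?_
      intro a ha b hb
      rw [List.getLast?_eq_some_getLast hne] at ha
      cases ha
      simp only [List.head?_cons, Option.mem_def, Option.some.injEq] at hb
      subst hb
      exact hadj, List.nodup_append.2 ⟨hnd, by simp, fun a ha b hb h => hvw (by
        rw [← List.mem_singleton.1 hb, ← h]; exact ha)⟩, by
        intro u hu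
        rcases List.mem_append.1 hu with h | h
        · exact hs u h
        · rw [List.mem_singleton.1 h]; exact hv, by simp⟩
    omega

theorem card_neighbors_le_of_maximal [DecidableEq V] (G : SimpleGraph V) [DecidableRel G.Adj]
    (C : Finset V) (ws : List V) (w : V) (hw : w ∈ ws)
    (h : ∀ v ∈ C, G.Adj w v → v ∈ ws) : (C.filter (G.Adj w)).card + 1 ≤ ws.length := by
  have h1 : C.filter (G.Adj w) ⊆ ws.toFinset.erase w := by
    intro v hv
    rw [Finset.mem_filter] at hv
    simp [h v hv.1 hv.2, hv.2.ne']
  have h2 := Finset.card_le_card h1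
  rw [Finset.card_erase_of_mem (by simpa using hw)] at h2
  have h3 := List.toFinset_card_le ws
  have h4 : 0 < ws.toFinset.card := Finset.card_pos.2 ⟨w, by simpa using hw⟩
  omega

end Lists

/-! ### Greedy embedding of the tree along a path. -/

section Copies

variable {V W : Type*}

/-- `G` has a copy of `F` with all vertices in `A`. -/
def HasCopyIn {X : Type*} (F : SimpleGraph X) (G : SimpleGraph V) (A : Finset V) : Prop :=
  ∃ f : Copy F G, ∀ z, f z ∈ A

/-- Hall's condition is immediate: each single set is already as large as the index set. -/
theorem exists_injective_choice {ι : Type*} [Fintype ι] [DecidableEq V] (t : ι → Finset V)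
    (h : ∀ i, Fintype.card ι ≤ (t i).card) :
    ∃ f : ι → V, Function.Injective f ∧ ∀ i, f i ∈ t i := by
  rw [← Finset.all_card_le_biUnion_card_iff_exists_injective]
  intro s
  rcases s.eq_empty_or_nonempty with rfl | ⟨i, hi⟩
  · simp
  · calc s.card ≤ Fintype.card ι := Finset.card_le_univ s
      _ ≤ (t i).card := h i
      _ ≤ _ := Finset.card_le_card (Finset.subset_biUnion_of_mem t hi)

/-- The path carries `c'`, `c`, `x` and the pendant path, in this order. The other `m - r - 3`
vertices are leaves at the two centers. Each center has at least `m - 1` neighbours in `A`, of which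
at most `r + 2` are on the path, so enough remain to choose all leaves distinct. -/
theorem hasCopyIn_of_path [Fintype W] [DecidableEq V] {S : SimpleGraph W} {c c' x y : W}
    (hS : IsFrame S c c' x y) {G : SimpleGraph V} [DecidableRel G.Adj] {r m : ℕ}
    (hm : Fintype.card W + r = m) (A : Finset V) (p : ℕ → V)
    (hinj : Set.InjOn p (Set.Iio (r + 3))) (hadj : ∀ i < r + 2, G.Adj (p i) (p (i + 1)))
    (hpA : ∀ i < r + 3, p i ∈ A) (h0 : m ≤ (A.filter (G.Adj (p 0))).card + 1)
    (h1 : m ≤ (A.filter (G.Adj (p 1))).card + 1) :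
    HasCopyIn (attachPath S x r) G A := by
  classical
  let ι := {w : W // w ≠ c ∧ w ≠ c' ∧ w ≠ x}
  let P : Finset V := (Finset.range (r + 3)).image p
  have hPc : P.card = r + 3 := by
    rw [Finset.card_image_of_injOn, Finset.card_range]
    simpa [Set.InjOn] using hinj
  have hι : Fintype.card ι + 3 = Fintype.card W := by
    have h3 : ({c, c', x} : Finset W).card = 3 :=
      Finset.card_eq_three.2 ⟨c, c', x, hS.adj_centers.ne, hS.adj_x.ne, hS.x_ne.symm, rfl⟩
    have : Fintype.card ι = (({c, c', x} : Finset W)ᶜ).card := by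
      rw [Fintype.card_subtype]
      congr 1
      ext w
      simp
    rw [this, ← h3, Finset.card_compl_add_card]
  have hopt : ∀ q ∈ P, m ≤ (A.filter (G.Adj q)).card + 1 →
      Fintype.card ι ≤ (A.filter (G.Adj q) \ P).card := by
    intro q hq hdeg
    -- A vertex is not its own neighbour, so only `r + 2` path vertices have to be discarded, which
    -- makes the count exact.
    have h2 : (A.filter (G.Adj q)) \ P = (A.filter (G.Adj q)) \ (P.erase q) := by
      ext v
      simp only [Finset.mem_sdiff, Finset.mem_filter, Finset.mem_erase]
      constructor
      · rintro ⟨h, h'⟩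
        exact ⟨h, fun h'' => h' h''.2⟩
      · rintro ⟨h, h'⟩
        exact ⟨h, fun h'' => h' ⟨h.2.ne', h''⟩⟩
    have h3 := Finset.le_card_sdiff (P.erase q) (A.filter (G.Adj q))
    rw [Finset.card_erase_of_mem hq, hPc] at h3
    rw [h2]
    omega
  have hmemP : ∀ i < r + 3, p i ∈ P := fun i hi =>
    Finset.mem_image_of_mem _ (Finset.mem_range.2 hi)
  obtain ⟨g, hginj, hg⟩ := exists_injective_choice
    (fun w : ι => if S.Adj c' w.1 then A.filter (G.Adj (p 0)) \ P else A.filter (G.Adj (p 1)) \ P)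
    (fun w => by
      split_ifs
      · exact hopt _ (hmemP 0 (by omega)) h0
      · exact hopt _ (hmemP 1 (by omega)) h1)
  have hgA : ∀ w, g w ∈ A ∧ g w ∉ P := fun w => by
    have := hg w
    split_ifs at this
    all_goals
      simp only [Finset.mem_sdiff, Finset.mem_filter] at this
      exact ⟨this.1.1, this.2⟩
  have hg0 : ∀ w : ι, S.Adj c' w.1 → G.Adj (p 0) (g w) := fun w hw => by
    have := hg w
    rw [if_pos hw] at this
    simp only [Finset.mem_sdiff, Finset.mem_filter] at this
    exact this.1.2
  have hg1 : ∀ w : ι, S.Adj c w.1 → G.Adj (p 1) (g w) := fun w hw => by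
    have hn : ¬ S.Adj c' w.1 := fun h =>
      hS.adj_centers.ne (hS.eq_of_adj w.2.1 w.2.2.1 hw.symm h.symm)
    have := hg w
    rw [if_neg hn] at this
    simp only [Finset.mem_sdiff, Finset.mem_filter] at this
    exact this.1.2
  -- position of a vertex of the spine on the path
  let f0 : W → V := fun w =>
    if hc' : w = c' then p 0 else if hc : w = c then p 1 else if hx : w = x then p 2
    else g ⟨w, hc, hc', hx⟩
  have fc' : f0 c' = p 0 := by simp [f0]
  have fc : f0 c = p 1 := by simp [f0, hS.adj_centers.ne]
  have fx : f0 x = p 2 := by simp [f0, hS.x_ne, hS.adj_x.ne']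
  have fg : ∀ w : ι, f0 w.1 = g w := fun w => by
    simp only [f0, w.2.1, w.2.2.1, w.2.2.2, dif_neg, not_false_eq_true]
    rfl
  have hcases : ∀ w, w = c' ∨ w = c ∨ w = x ∨ ∃ w' : ι, w = w'.1 := by
    intro w
    by_cases h1 : w = c'
    · exact Or.inl h1
    by_cases h2 : w = c
    · exact Or.inr (Or.inl h2)
    by_cases h3 : w = x
    · exact Or.inr (Or.inr (Or.inl h3))
    exact Or.inr (Or.inr (Or.inr ⟨⟨w, h2, h1, h3⟩, rfl⟩))
  have hpos : ∀ w, (∃ i < 3, f0 w = p i ∧ (i = 0 → w = c') ∧ (i = 1 → w = c) ∧ (i = 2 → w = x)) ∨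
      ∃ w' : ι, w = w'.1 ∧ f0 w = g w' := by
    intro w
    rcases hcases w with rfl | rfl | rfl | ⟨w', rfl⟩
    · exact Or.inl ⟨0, by omega, fc', by simp, by simp, by simp⟩
    · exact Or.inl ⟨1, by omega, fc, by simp, by simp, by simp⟩
    · exact Or.inl ⟨2, by omega, fx, by simp, by simp, by simp⟩
    · exact Or.inr ⟨w', rfl, fg w'⟩
  have f0inj : Function.Injective f0 := by
    intro a b hab
    rcases hpos a with ⟨i, hi, hai, ha0, ha1, ha2⟩ | ⟨a', rfl, hai⟩ <;>
    rcases hpos b with ⟨j, hj, hbj, hb0, hb1, hb2⟩ | ⟨b', rfl, hbj⟩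
    · have hij : i = j := hinj (Set.mem_Iio.2 (by omega)) (Set.mem_Iio.2 (by omega))
        (by rw [← hai, ← hbj, hab])
      subst hij
      interval_cases i
      · rw [ha0 rfl, hb0 rfl]
      · rw [ha1 rfl, hb1 rfl]
      · rw [ha2 rfl, hb2 rfl]
    · exfalso
      apply (hgA b').2
      rw [← hbj, ← hab, hai]
      exact hmemP i (by omega)
    · exfalso
      apply (hgA a').2
      rw [← hai, hab, hbj]
      exact hmemP j (by omega)
    · rw [hginj (hai.symm.trans (hab.trans hbj))]
  have f0A : ∀ w, f0 w ∈ A := by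
    intro w
    rcases hpos w with ⟨i, hi, h, -⟩ | ⟨w', rfl, h⟩
    · rw [h]; exact hpA i (by omega)
    · rw [h]; exact (hgA w').1
  have hadjc' : ∀ b, S.Adj c' b → G.Adj (f0 c') (f0 b) := by
    intro b hb
    rcases hcases b with rfl | rfl | rfl | ⟨w', rfl⟩
    · exact absurd hb (S.irrefl)
    · rw [fc', fc]; exact hadj 0 (by omega)
    · exact absurd (hS.eq_of_adj hS.adj_x.ne' hS.x_ne hb.symm hS.adj_x.symm)
        hS.adj_centers.ne'
    · rw [fc', fg]; exact hg0 w' hb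
  have hadjc : ∀ b, S.Adj c b → G.Adj (f0 c) (f0 b) := by
    intro b hb
    rcases hcases b with rfl | rfl | rfl | ⟨w', rfl⟩
    · rw [fc', fc]; exact (hadj 0 (by omega)).symm
    · exact absurd hb (S.irrefl)
    · rw [fc, fx]; exact hadj 1 (by omega)
    · rw [fc, fg]; exact hg1 w' hb
  have hadjS : ∀ a b, S.Adj a b → G.Adj (f0 a) (f0 b) := by
    intro a b hab
    rcases hS.center_of_adj hab with rfl | rfl | rfl | rfl
    · exact hadjc b hab
    · exact hadjc' b hab
    · exact (hadjc a hab.symm).symm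
    · exact (hadjc' a hab.symm).symm
  let f : W ⊕ Fin r → V := Sum.elim f0 fun j => p (j + 3)
  have hne : ∀ w (j : Fin r), f0 w ≠ p (j + 3) := by
    intro w j h
    rcases hpos w with ⟨i, hi, h', -⟩ | ⟨w', rfl, h'⟩
    · have := hinj (Set.mem_Iio.2 (by omega)) (Set.mem_Iio.2 (by omega)) (h'.symm.trans h)
      omega
    · apply (hgA w').2
      rw [← h', h]
      exact hmemP _ (by omega)
  refine ⟨⟨⟨f, ?_⟩, ?_⟩, ?_⟩
  · rintro (a | i) (b | j) h
    · exact hadjS a b h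
    · obtain ⟨rfl, hj⟩ : a = x ∧ j.val = 0 := h
      change G.Adj (f0 a) (p (j + 3))
      rw [fx, hj]
      exact hadj 2 (by omega)
    · obtain ⟨rfl, hj⟩ : b = x ∧ i.val = 0 := h
      change G.Adj (p (i + 3)) (f0 b)
      rw [fx, hj]
      exact (hadj 2 (by omega)).symm
    · have h' : i.val + 1 = j.val ∨ j.val + 1 = i.val := h
      change G.Adj (p (i + 3)) (p (j + 3))
      rcases h' with h' | h'
      · rw [← h', Nat.add_right_comm]; exact hadj _ (by omega)
      · rw [← h', Nat.add_right_comm]; exact (hadj _ (by omega)).symm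
  · rintro (a | i) (b | j) h
    · exact congrArg _ (f0inj h)
    · exact absurd h (hne a j)
    · exact absurd h.symm (hne b i)
    · have h' : p (i + 3) = p (j + 3) := h
      have := hinj (Set.mem_Iio.2 (by omega)) (Set.mem_Iio.2 (by omega)) h'
      exact congrArg _ (Fin.ext (by omega))
  · rintro (a | i)
    · exact f0A a
    · exact hpA _ (by omega)

theorem hasCopyIn_of_list [Fintype W] [DecidableEq V] {S : SimpleGraph W} {c c' x y : W}
    (hS : IsFrame S c c' x y) {G : SimpleGraph V} [DecidableRel G.Adj] {r m : ℕ}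
    (hm : Fintype.card W + r = m) (A : Finset V) (q₁ q₂ : V) (L : List V)
    (hch : (q₁ :: q₂ :: L).IsChain G.Adj) (hnd : (q₁ :: q₂ :: L).Nodup)
    (hA : ∀ v ∈ q₁ :: q₂ :: L, v ∈ A) (hL : r + 1 ≤ L.length)
    (h0 : m ≤ (A.filter (G.Adj q₁)).card + 1) (h1 : m ≤ (A.filter (G.Adj q₂)).card + 1) :
    HasCopyIn (attachPath S x r) G A := by
  set Q := q₁ :: q₂ :: L with hQ
  have hlen : r + 3 ≤ Q.length := by simp [hQ]; omega
  have hget : ∀ i (hi : i < Q.length), Q.getD i q₁ = Q[i] := fun i hi => by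
    simp [List.getD_eq_getElem?_getD, hi]
  refine hasCopyIn_of_path hS hm A (fun i => Q.getD i q₁) ?_ ?_ ?_ h0 h1
  · intro i hi j hj hij
    have hi' : i < Q.length := lt_of_lt_of_le hi hlen
    have hj' : j < Q.length := lt_of_lt_of_le hj hlen
    dsimp only at hij
    rw [hget i hi', hget j hj'] at hij
    exact (hnd.getElem_inj_iff).1 hij
  · intro i hi
    rw [hget i (by omega), hget (i + 1) (by omega)]
    exact List.isChain_iff_getElem.1 hch i (by omega)
  · intro i hi
    rw [hget i (by omega)]
    exact hA _ (List.getElem_mem _)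

/-- The head of an inextensible path has all its neighbours in `A` on that path, so the path has at
least `m ≥ r + 3` vertices. -/
theorem hasCopyIn_of_minDegree [Fintype W] [DecidableEq V] {S : SimpleGraph W} {c c' x y : W}
    (hS : IsFrame S c c' x y) {G : SimpleGraph V} [DecidableRel G.Adj] {r m : ℕ}
    (hm : Fintype.card W + r = m) (hrm : r + 3 ≤ m) (A : Finset V) (hA : A.Nonempty)
    (hdeg : ∀ w ∈ A, m ≤ (A.filter (G.Adj w)).card + 1) :
    HasCopyIn (attachPath S x r) G A := by
  obtain ⟨ws, hch, hnd, hs, hne, hhead, -⟩ := exists_maximal_path_list G A hA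
  have hlen := card_neighbors_le_of_maximal G A ws _ (List.head_mem hne) hhead
  have hd := hdeg _ (hs _ (List.head_mem hne))
  match ws, hch, hnd, hs, hlen.trans' hd with
  | [], _, _, _, h => simp at h; omega
  | [_], _, _, _, h => simp at h; omega
  | q₁ :: q₂ :: L, hch, hnd, hs, h =>
    simp only [List.length_cons] at h
    exact hasCopyIn_of_list hS hm A q₁ q₂ L hch hnd hs (by omega) (hdeg _ (hs _ (by simp)))
      (hdeg _ (hs _ (by simp)))

end Copies

/-! ### Splitting a list at its first or last element with a property. -/

section Split

variable {α : Type*}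

theorem exists_split_first (p : α → Prop) (L : List α) (h : ∃ a ∈ L, p a) :
    ∃ L₁ a L₂, L = L₁ ++ a :: L₂ ∧ p a ∧ ∀ b ∈ L₁, ¬ p b := by
  induction L with
  | nil => simp at h
  | cons c L ih =>
    by_cases hc : p c
    · exact ⟨[], c, L, rfl, hc, by simp⟩
    · obtain ⟨a, ha, hpa⟩ := h
      have ha' : a ∈ L := by
        rcases List.mem_cons.1 ha with rfl | h
        · exact absurd hpa hc
        · exact h
      obtain ⟨L₁, a, L₂, rfl, h1, h2⟩ := ih ⟨a, ha', hpa⟩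
      exact ⟨c :: L₁, a, L₂, rfl, h1, by simpa [hc] using h2⟩

theorem exists_split_last (p : α → Prop) (L : List α) (h : ∃ a ∈ L, p a) :
    ∃ L₁ a L₂, L = L₁ ++ a :: L₂ ∧ p a ∧ ∀ b ∈ L₂, ¬ p b := by
  obtain ⟨L₁, a, L₂, h1, h2, h3⟩ := exists_split_first p L.reverse (by simpa using h)
  refine ⟨L₂.reverse, a, L₁.reverse, ?_, h2, by simpa using h3⟩
  rw [← L.reverse_reverse, h1]
  simp

theorem exists_split_prefix (p : α → Prop) (L : List α) :
    ∃ L₁ L₂, L = L₁ ++ L₂ ∧ (∀ b ∈ L₁, ¬ p b) ∧ ∀ b ∈ L₂.head?, p b := by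
  by_cases h : ∃ a ∈ L, p a
  · obtain ⟨L₁, a, L₂, h1, h2, h3⟩ := exists_split_first p L h
    exact ⟨L₁, a :: L₂, h1, h3, by simpa using h2⟩
  · push Not at h
    exact ⟨L, [], by simp, h, by simp⟩

end Split

/-! ### The spine of the tree: a leaf, the two centers, the pendant path. -/

section Spine

variable {W : Type*}

/-- The pendant path of `attachPath S x r`, starting at `x`. -/
def tailList (x : W) (r : ℕ) : List (W ⊕ Fin r) := Sum.inl x :: (List.finRange r).map Sum.inr

theorem length_tailList (x : W) (r : ℕ) : (tailList x r).length = r + 1 := by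
  simp [tailList]

theorem isChain_tailList (S : SimpleGraph W) (x : W) (r : ℕ) :
    (tailList x r).IsChain (attachPath S x r).Adj := by
  rw [List.isChain_iff_getElem]
  intro i hi
  rw [length_tailList] at hi
  rcases i with _ | i
  · simp only [tailList, List.getElem_cons_zero, List.getElem_cons_succ, List.getElem_map,
      List.getElem_finRange]
    exact ⟨rfl, rfl⟩
  · simp only [tailList, List.getElem_cons_succ, List.getElem_map, List.getElem_finRange]
    exact Or.inl rfl

theorem isChain_spine {S : SimpleGraph W} {c c' x y : W} (hS : IsFrame S c c' x y) (r : ℕ) :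
    ([Sum.inl y, Sum.inl c', Sum.inl c] ++ tailList x r).IsChain (attachPath S x r).Adj := by
  refine List.IsChain.append ?_ (isChain_tailList S x r) ?_
  · simp only [List.isChain_cons_cons, List.isChain_singleton, and_true]
    exact ⟨hS.adj_y.symm, hS.adj_centers.symm⟩
  · simp only [tailList, List.getLast?_cons_cons, List.getLast?_singleton, List.head?_cons,
      Option.mem_def, Option.some.injEq]
    rintro _ rfl _ rfl
    exact hS.adj_x

theorem nodup_spine {S : SimpleGraph W} {c c' x y : W} (hS : IsFrame S c c' x y) (r : ℕ) :
    ([Sum.inl y, Sum.inl c', Sum.inl c] ++ tailList x r).Nodup := by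
  have hyx : y ≠ x := by
    rintro rfl
    exact hS.adj_centers.ne (hS.eq_of_adj hS.y_ne hS.adj_y.ne' hS.adj_x.symm hS.adj_y.symm)
  have h : ((List.finRange r).map (Sum.inr : Fin r → W ⊕ Fin r)).Nodup :=
    (List.nodup_finRange r).map Sum.inr_injective
  simp [tailList, h, hS.adj_y.ne', hS.y_ne, hyx, hS.adj_centers.ne', hS.x_ne.symm, hS.adj_x.ne]

end Spine

/-! ### Freeing a vertex of `U` from the tree. -/

section Exchange

variable {V W : Type*}

/-- If no vertex of `U` can be freed, every copy in `H` covers `U`. A longest path `ws` among the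
vertices of `H` off the copy has ends with many neighbours on the pendant path `T`. This forces `U`
into `T`, and a detour through `ws` then bypasses a vertex of `U` without making the spine too
short. -/
theorem exists_hasCopyIn_erase [Fintype W] [DecidableEq V] {S : SimpleGraph W} {c c' x y : W}
    (hS : IsFrame S c c' x y) {G : SimpleGraph V} [DecidableRel G.Adj] {r m : ℕ}
    (hm : Fintype.card W + r = m) (hrm : r + 4 ≤ m) (H U : Finset V) (hUne : U.Nonempty)
    (hdeg : ∀ w ∈ H, w ∉ U → m + 1 ≤ (H.filter (G.Adj w)).card) (hH : m < H.card)
    (hcopy : HasCopyIn (attachPath S x r) G H) :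
    ∃ u ∈ U, HasCopyIn (attachPath S x r) G (H.erase u) := by
  classical
  by_contra! hno
  obtain ⟨f, hf⟩ := hcopy
  set M : Finset V := Finset.univ.image f with hM
  have hfM : ∀ z, f z ∈ M := fun z => Finset.mem_image_of_mem _ (Finset.mem_univ z)
  have finj : Function.Injective f := f.injective
  have hMcard : M.card = m := by
    rw [hM, Finset.card_image_of_injective _ finj, Finset.card_univ, Fintype.card_sum,
      Fintype.card_fin, hm]
  have hMH : M ⊆ H := by
    intro v hv
    obtain ⟨z, -, rfl⟩ := Finset.mem_image.1 hv
    exact hf z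
  have hUM : ∀ u ∈ U, u ∈ M := by
    intro u hu
    by_contra hn
    refine hno u hu ⟨f, fun z => Finset.mem_erase.2 ⟨fun h => hn ?_, hf z⟩⟩
    rw [← h]; exact hfM z
  have hdeg' : ∀ u, ∀ w ∈ H, w ∉ U → m ≤ ((H.erase u).filter (G.Adj w)).card := by
    intro u w hw hwU
    have h1 := hdeg w hw hwU
    have h2 : (H.filter (G.Adj w)).erase u ⊆ (H.erase u).filter (G.Adj w) := by
      intro v hv
      simp only [Finset.mem_erase, Finset.mem_filter] at hv ⊢
      tauto
    have h3 := Finset.card_le_card h2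
    have h4 := Finset.pred_card_le_card_erase (s := H.filter (G.Adj w)) (a := u)
    omega
  -- Only the two prospective centers must lie outside `U`: their `m + 1` neighbours in `H` leave at
  -- least `m` after `u` is erased.
  have key : ∀ (Q : List V) (u : V), Q.IsChain G.Adj → Q.Nodup → (∀ v ∈ Q, v ∈ H) →
      (∀ v ∈ Q.take 2, v ∉ U) → u ∈ U → u ∉ Q → r + 3 ≤ Q.length → False := by
    intro Q u hch hnd hQH hQU hu huQ hlen
    match Q, hch, hnd, hQH, hQU, huQ, hlen with
    | [], _, _, _, _, _, h => simp at h
    | [_], _, _, _, _, _, h => simp at h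
    | q₁ :: q₂ :: L, hch, hnd, hQH, hQU, huQ, h =>
      simp only [List.length_cons] at h
      refine hno u hu (hasCopyIn_of_list hS hm (H.erase u) q₁ q₂ L hch hnd ?_ (by omega) ?_ ?_)
      · intro v hv
        exact Finset.mem_erase.2 ⟨fun h => huQ (h ▸ hv), hQH v hv⟩
      · have := hdeg' u q₁ (hQH _ (by simp)) (hQU _ (by simp))
        omega
      · have := hdeg' u q₂ (hQH _ (by simp)) (hQU _ (by simp))
        omega
  -- If `u` were the only vertex of `U`, all of `H` without `u` would have large enough degree for
  -- the greedy embedding.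
  have hU2 : ∀ u ∈ U, ∃ u' ∈ U, u' ≠ u := by
    intro u hu
    by_contra! hall
    refine hno u hu (hasCopyIn_of_minDegree hS hm (by omega) (H.erase u) ?_ ?_)
    · rw [← Finset.card_pos, Finset.card_erase_of_mem (hMH (hUM u hu))]
      omega
    · intro w hw
      rw [Finset.mem_erase] at hw
      have := hdeg' u w hw.2 fun h => hw.1 (hall w h)
      omega
  set C : Finset V := H \ M with hC
  have hCne : C.Nonempty := by
    rw [← Finset.card_pos, hC, Finset.card_sdiff_of_subset hMH]
    omega
  have hCM : ∀ v ∈ C, v ∉ M := fun v hv => (Finset.mem_sdiff.1 hv).2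
  have hCH : ∀ v ∈ C, v ∈ H := fun v hv => (Finset.mem_sdiff.1 hv).1
  have hCU : ∀ v ∈ C, v ∉ U := fun v hv h => hCM v hv (hUM v h)
  obtain ⟨ws, hch, hnd, hws, hne, hhead, hlast⟩ := exists_maximal_path_list G C hCne
  set l := ws.length with hl
  set T : List V := (tailList x r).map f with hT
  have hTlen : T.length = r + 1 := by rw [hT, List.length_map, length_tailList]
  have hspch : ([f (Sum.inl y), f (Sum.inl c'), f (Sum.inl c)] ++ T).IsChain G.Adj := by
    have := List.isChain_map_of_isChain (S := G.Adj) f (fun a b h => f.toHom.map_adj h)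
      (isChain_spine hS r)
    simpa [hT] using this
  have hspnd : ([f (Sum.inl y), f (Sum.inl c'), f (Sum.inl c)] ++ T).Nodup := by
    have := (nodup_spine hS r).map f.injective
    simpa [hT] using this
  have hTch := hspch.right_of_append
  have hTnd := (List.nodup_append.1 hspnd).2.1
  have hTM : ∀ v ∈ T, v ∈ M := by
    intro v hv
    obtain ⟨z, -, rfl⟩ := List.mem_map.1 hv
    exact hfM z
  -- An end of `ws` has at most `l - 1` neighbours in `C`, hence at least `m + 2 - l` in `M`. It
  -- misses at most `l - 2` vertices of `M`, and so at most that many of the `r + 1` vertices of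
  -- `T`.
  have hcount : ∀ w ∈ ws, (∀ v ∈ C, G.Adj w v → v ∈ ws) →
      2 ≤ l ∧ r + 3 ≤ l + T.countP (fun v => G.Adj w v) := by
    intro w hw hmax
    have h1 := hdeg w (hCH _ (hws w hw)) (hCU _ (hws w hw))
    have h2 := card_neighbors_le_of_maximal G C ws w hw hmax
    have h3 : (H.filter (G.Adj w)).card ≤ (C.filter (G.Adj w)).card + (M.filter (G.Adj w)).card := by
      rw [← Finset.sdiff_union_of_subset hMH, Finset.filter_union]
      exact Finset.card_union_le _ _
    have h4 : (M.filter (G.Adj w)).card ≤ m := hMcard ▸ Finset.card_filter_le _ _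
    have h5 : M.filter (G.Adj w) ⊆ (M \ T.toFinset) ∪ (T.filter (fun v => G.Adj w v)).toFinset := by
      intro v hv
      simp only [Finset.mem_filter, Finset.mem_union, Finset.mem_sdiff, List.mem_toFinset,
        List.mem_filter, decide_eq_true_eq] at hv ⊢
      tauto
    have h6 := (Finset.card_le_card h5).trans (Finset.card_union_le _ _)
    have h7 : (M \ T.toFinset).card = m - (r + 1) := by
      rw [Finset.card_sdiff_of_subset (fun v hv => hTM v (by simpa using hv)), hMcard,
        List.toFinset_card_of_nodup hTnd, hTlen]
    have h8 := List.toFinset_card_le (T.filter (fun v => G.Adj w v))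
    rw [← List.countP_eq_length_filter] at h8
    omega
  obtain ⟨hl2, hcnt₁⟩ := hcount _ (List.head_mem hne) hhead
  obtain ⟨-, hcnt₂⟩ := hcount _ (List.getLast_mem hne) hlast
  obtain ⟨u₀, hu₀⟩ := hUne
  have hl3 : l ≤ r + 2 := by
    by_contra hlt
    exact key ws u₀ hch hnd (fun v hv => hCH v (hws v hv))
      (fun v hv => hCU v (hws v (List.mem_of_mem_take hv))) hu₀
      (fun h => hCU _ (hws _ h) hu₀) (by omega)
  -- an end of the path in `C` has its first neighbour on the tail before all of `U`
  have hfirst : ∀ (ws : List V) (w : V), ws.IsChain G.Adj → ws.Nodup → (∀ v ∈ ws, v ∈ C) →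
      ws.length = l → ws.getLast? = some w → r + 3 ≤ l + T.countP (fun v => G.Adj w v) →
      ∃ L₁ a L₂, T = L₁ ++ a :: L₂ ∧ G.Adj w a ∧ ∀ u ∈ U, u ∈ a :: L₂ := by
    intro ws w hch hnd hws hlen hlast hcnt
    obtain ⟨L₁, a, L₂, hTs, hwa, hL₁⟩ := exists_split_first (fun v => G.Adj w v) T (by
      have : 0 < T.countP (fun v => G.Adj w v) := by omega
      simpa using List.countP_pos_iff.1 this)
    refine ⟨L₁, a, L₂, hTs, hwa, fun u hu => ?_⟩
    by_contra hua
    have hsub : ∀ v ∈ a :: L₂, v ∈ M := fun v hv => hTM v (by rw [hTs]; exact List.mem_append_right _ hv)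
    have hc1 : L₁.countP (fun v => G.Adj w v) = 0 := by
      rw [List.countP_eq_zero]; simpa using hL₁
    have hc2 := List.countP_le_length (p := fun v => decide (G.Adj w v)) (l := a :: L₂)
    rw [hTs, List.countP_append, hc1] at hcnt
    -- Running along `ws` and then down `T` from the first neighbour `a` gives at least `l + (r + 3
    -- - l)` vertices.
    refine key (ws ++ a :: L₂) u ?_ ?_ ?_ ?_ hu ?_ ?_
    · refine hch.append (hTs ▸ hTch).right_of_append ?_
      intro p hp q hq
      rw [hlast] at hp
      cases hp
      cases hq
      exact hwa
    · exact List.nodup_append.2 ⟨hnd, (List.nodup_append.1 (hTs ▸ hTnd)).2.1,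
        fun p hp q hq h => hCM p (hws p hp) (h ▸ hsub q hq)⟩
    · intro v hv
      rcases List.mem_append.1 hv with h | h
      · exact hCH v (hws v h)
      · exact hMH (hsub v h)
    · intro v hv
      rw [List.take_append_of_le_length (by omega)] at hv
      exact hCU v (hws v (List.mem_of_mem_take hv))
    · intro h
      rcases List.mem_append.1 h with h | h
      · exact hCU u (hws u h) hu
      · exact hua h
    · rw [List.length_append, hlen]
      omega
  have hlast₁ : ws.getLast? = some (ws.getLast hne) := List.getLast?_eq_some_getLast hne
  have hlast₂ : ws.reverse.getLast? = some (ws.head hne) := by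
    rw [List.getLast?_reverse, List.head?_eq_some_head hne]
  have hrev : ws.reverse.IsChain G.Adj := by
    rw [List.isChain_reverse]
    exact hch.imp fun a b h => h.symm
  have hf₁ := hfirst ws _ hch hnd hws rfl hlast₁ hcnt₂
  have hf₂ := hfirst ws.reverse _ hrev (List.nodup_reverse.2 hnd) (by simpa using hws) (by simp [hl])
    hlast₂ hcnt₁
  have hUT : ∀ u ∈ U, u ∈ T := by
    obtain ⟨L₁, a, L₂, hTs, -, h⟩ := hf₁
    intro u hu
    rw [hTs]
    exact List.mem_append_right _ (h u hu)
  -- The vertex to bypass is the last one of `U` on `T`. A second vertex `u'` of `U` then precedes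
  -- it, so both ends of `ws` have neighbours before `u`.
  obtain ⟨A, u, D, hTs, hu, hD⟩ := exists_split_last (· ∈ U) T ⟨u₀, hUT u₀ hu₀, hu₀⟩
  obtain ⟨u', hu', hne'⟩ := hU2 u hu
  have hu'D : u' ∉ u :: D := by
    intro h
    rcases List.mem_cons.1 h with h | h
    · exact hne' h
    · exact hD u' h hu'
  -- Around `u`, the stretches `A₂` and `D₁` contain no neighbours of `w`, so their total length is
  -- at most the `l - 2` vertices that `w` can miss.
  have hsplit : ∀ w, r + 3 ≤ l + T.countP (fun v => G.Adj w v) →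
      (∃ L₁ a L₂, T = L₁ ++ a :: L₂ ∧ G.Adj w a ∧ ∀ u ∈ U, u ∈ a :: L₂) →
      ∃ A₁ a A₂ D₁ D₂, A = A₁ ++ a :: A₂ ∧ D = D₁ ++ D₂ ∧ G.Adj w a ∧
        (∀ b ∈ D₂.head?, G.Adj w b) ∧ A₂.length + D₁.length + 2 ≤ l := by
    rintro w hcnt ⟨L₁, a, L₂, hTs', hwa, hL⟩
    have haA : a ∈ A := by
      rw [hTs] at hTs'
      rcases List.append_eq_append_iff.1 hTs' with ⟨X, h1, h2⟩ | ⟨X, h1, h2⟩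
      · exact absurd (by rw [h2]; exact List.mem_append_right _ (hL u' hu')) hu'D
      · rcases X with _ | ⟨b, X⟩
        · exact absurd (by have := hL u' hu'; rwa [h2] at this) hu'D
        · rw [List.cons_append, List.cons.injEq] at h2
          rw [h1, h2.1]
          simp
    obtain ⟨A₁, a', A₂, hA, hwa', hA₂⟩ := exists_split_last (fun v => G.Adj w v) A ⟨a, haA, hwa⟩
    obtain ⟨D₁, D₂, hDs, hD₁, hD₂⟩ := exists_split_prefix (fun v => G.Adj w v) D
    refine ⟨A₁, a', A₂, D₁, D₂, hA, hDs, hwa', hD₂, ?_⟩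
    have hc1 : A₂.countP (fun v => G.Adj w v) = 0 := by
      rw [List.countP_eq_zero]; simpa using hA₂
    have hc2 : D₁.countP (fun v => G.Adj w v) = 0 := by
      rw [List.countP_eq_zero]; simpa using hD₁
    have hc3 := List.countP_le_length (p := fun v => decide (G.Adj w v)) (l := A₁ ++ [a'])
    have hc4 := List.countP_le_length (p := fun v => decide (G.Adj w v)) (l := [u])
    have hc5 := List.countP_le_length (p := fun v => decide (G.Adj w v)) (l := D₂)
    have hTs2 : T = (A₁ ++ [a']) ++ (A₂ ++ ([u] ++ (D₁ ++ D₂))) := by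
      rw [hTs, hA, hDs]; simp
    have hTlen2 := hTlen
    rw [hTs2] at hcnt hTlen2
    simp only [List.countP_append, hc1, hc2] at hcnt hc3
    simp only [List.length_append, List.length_singleton] at hTlen2 hc3 hc4
    omega
  obtain ⟨A₁, a, A₂, D₁, D₂, hA, hDs, hwa, hwD, hab⟩ := hsplit _ hcnt₁ hf₂
  obtain ⟨A₁', a', A₂', D₁', D₂', hA', hDs', hwa', hwD', hab'⟩ := hsplit _ hcnt₂ hf₁
  -- The detour replaces `A₂`, `u`, `D₁` by the `l` vertices of `ws`. The old spine with its extra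
  -- leaf `y` has `r + 4` vertices, so losing one net vertex is affordable. The first two vertices,
  -- the images of `y` and `c'`, avoid `U` because `U` lies in `T`.
  have hfinal : ∀ (ws : List V) (w₁ w₂ : V), ws.IsChain G.Adj → ws.Nodup → (∀ v ∈ ws, v ∈ C) →
      ws.length = l → ws.head? = some w₁ → ws.getLast? = some w₂ →
      ∀ A₁ a A₂ D₁ D₂, A = A₁ ++ a :: A₂ → D = D₁ ++ D₂ → G.Adj w₁ a →
        (∀ b ∈ D₂.head?, G.Adj w₂ b) → A₂.length + D₁.length ≤ l → False := by
    intro ws w₁ w₂ hch hnd hws hlen hhead hlast A₁ a A₂ D₁ D₂ hA hDs hwa hwD hab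
    have hTs2 : [f (Sum.inl y), f (Sum.inl c'), f (Sum.inl c)] ++ T =
        (f (Sum.inl y) :: f (Sum.inl c') :: f (Sum.inl c) :: (A₁ ++ [a])) ++
          ((A₂ ++ [u] ++ D₁) ++ D₂) := by
      rw [hTs, hA, hDs]; simp
    have hspM : ∀ v ∈ [f (Sum.inl y), f (Sum.inl c'), f (Sum.inl c)] ++ T, v ∈ M := by
      intro v hv
      rcases List.mem_append.1 hv with h | h
      · simp only [List.mem_cons, List.not_mem_nil, or_false] at h
        rcases h with rfl | rfl | rfl <;> exact hfM _
      · exact hTM v h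
    have hTlen2 : A₁.length + 1 + A₂.length + 1 + D₁.length + D₂.length = r + 1 := by
      rw [← hTlen, hTs, hA, hDs]; simp; omega
    have hstart : ∀ v ∈ [f (Sum.inl y), f (Sum.inl c'), f (Sum.inl c)], v ∉ U :=
      fun v hv hvU => (List.nodup_append.1 hspnd).2.2 v hv v (hUT v hvU) rfl
    set P := f (Sum.inl y) :: f (Sum.inl c') :: f (Sum.inl c) :: (A₁ ++ [a]) with hP
    rw [hTs2] at hspM
    have hnd2 : (P ++ ((A₂ ++ [u] ++ D₁) ++ D₂)).Nodup := hTs2 ▸ hspnd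
    have hch2 : (P ++ ((A₂ ++ [u] ++ D₁) ++ D₂)).IsChain G.Adj := hTs2 ▸ hspch
    have hPM : ∀ v ∈ P, v ∈ M := fun v hv => hspM v (List.mem_append_left _ hv)
    have hDM : ∀ v ∈ D₂, v ∈ M := fun v hv =>
      hspM v (List.mem_append_right _ (List.mem_append_right _ hv))
    obtain ⟨hPnd, hXnd, hPX⟩ := List.nodup_append.1 hnd2
    obtain ⟨hYnd, hDnd, hYD⟩ := List.nodup_append.1 hXnd
    have huY : u ∈ A₂ ++ [u] ++ D₁ := by simp
    have hwsne : ws ≠ [] := by rintro rfl; simp at hhead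
    refine key (P ++ (ws ++ D₂)) u ?_ ?_ ?_ ?_ hu ?_ ?_
    · refine hch2.left_of_append.append (hch.append hch2.right_of_append.right_of_append ?_) ?_
      · intro p hp q hq
        rw [hlast] at hp
        cases hp
        exact hwD q hq
      · intro p hp q hq
        have hPl : P.getLast? = some a := by
          have : P = (f (Sum.inl y) :: f (Sum.inl c') :: f (Sum.inl c) :: A₁) ++ [a] := by simp [hP]
          rw [this, List.getLast?_concat]
        rw [hPl] at hp
        rw [List.head?_append_of_ne_nil _ hwsne, hhead] at hq
        cases hp
        cases hq
        exact hwa.symm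
    · refine List.nodup_append.2 ⟨hPnd, List.nodup_append.2 ⟨hnd, hDnd, ?_⟩, ?_⟩
      · exact fun p hp q hq h => hCM p (hws p hp) (h ▸ hDM q hq)
      · intro p hp q hq h
        rcases List.mem_append.1 hq with hq | hq
        · exact hCM q (hws q hq) (h ▸ hPM p hp)
        · exact hPX p hp q (List.mem_append_right _ hq) h
    · intro v hv
      rcases List.mem_append.1 hv with h | h
      · exact hMH (hPM v h)
      · rcases List.mem_append.1 h with h | h
        · exact hCH v (hws v h)
        · exact hMH (hDM v h)
    · intro v hv
      refine hstart v ?_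
      simp only [hP, List.cons_append, List.take_succ_cons, List.take_zero, List.mem_cons,
        List.not_mem_nil, or_false] at hv ⊢
      tauto
    · intro h
      rcases List.mem_append.1 h with h | h
      · exact hPX u h u (List.mem_append_left _ huY) rfl
      · rcases List.mem_append.1 h with h | h
        · exact hCU u (hws u h) hu
        · exact hYD u huY u h rfl
    · simp only [hP, List.length_append, List.length_cons, List.length_nil, hlen]
      omega
  have hhead₁ : ws.head? = some (ws.head hne) := List.head?_eq_some_head hne
  have hhead₂ : ws.reverse.head? = some (ws.getLast hne) := by
    rw [List.head?_reverse, hlast₁]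
  -- The detour enters at one end of `ws` and leaves at the other, so it skips `A₂` with `D₁'` or
  -- `A₂'` with `D₁`. These lengths sum to at most `2 * l - 4`, hence one orientation fits.
  rcases le_total (A₂.length + D₁'.length) l with h | h
  · exact hfinal ws _ _ hch hnd hws rfl hhead₁ hlast₁ A₁ a A₂ D₁' D₂' hA hDs' hwa hwD' h
  · exact hfinal ws.reverse _ _ hrev (List.nodup_reverse.2 hnd) (by simpa using hws) (by simp [hl])
      hhead₂ hlast₂ A₁' a' A₂' D₁ D₂ hA' hDs hwa' hwD (by omega)

end Exchange

/-! ### Adding ears to 2-connected sets. -/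

section Ears

variable {V : Type*}

/-- Any two vertices of `B` are joined by a walk inside `B` that avoids any prescribed third
vertex. -/
def IsRobust (G : SimpleGraph V) (B : Set V) : Prop :=
  ∀ v, ∀ a ∈ B, ∀ b ∈ B, a ≠ v → b ≠ v → ∃ p : G.Walk a b, ∀ z ∈ p.support, z ∈ B ∧ z ≠ v

theorem exists_walk_avoiding {G : SimpleGraph V} {x y : V} (p : G.Walk x y) (hp : p.IsPath)
    (v z : V) (hz : z ∈ p.support) (hzv : z ≠ v) :
    (∃ q : G.Walk z x, ∀ t ∈ q.support, t ∈ p.support ∧ t ≠ v) ∨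
      ∃ q : G.Walk z y, ∀ t ∈ q.support, t ∈ p.support ∧ t ≠ v := by
  classical
  induction p with
  | nil =>
    rw [Walk.support_nil, List.mem_singleton] at hz
    subst hz
    exact Or.inl ⟨Walk.nil, by simpa using hzv⟩
  | @cons a b c h p ih =>
    rw [Walk.cons_isPath_iff] at hp
    rw [Walk.support_cons, List.mem_cons] at hz
    by_cases hza : z = a
    · subst hza
      exact Or.inl ⟨Walk.nil, by simpa using hzv⟩
    have hz' : z ∈ p.support := hz.resolve_left hza
    by_cases hva : v = a
    · subst hva
      refine Or.inr ⟨p.dropUntil z hz', fun t ht => ?_⟩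
      have ht' := p.support_dropUntil_subset_support hz' ht
      refine ⟨by simp [ht'], ?_⟩
      rintro rfl
      exact hp.2 ht'
    · rcases ih hp.1 hz' with ⟨q, hq⟩ | ⟨q, hq⟩
      · refine Or.inl ⟨q.append (Walk.cons h.symm Walk.nil), fun t ht => ?_⟩
        rw [Walk.mem_support_append_iff] at ht
        rcases ht with ht | ht
        · exact ⟨by simp [(hq t ht).1], (hq t ht).2⟩
        · simp only [Walk.support_cons, Walk.support_nil, List.mem_cons, List.not_mem_nil,
            or_false] at ht
          rcases ht with rfl | rfl
          · exact ⟨by simp, (hq t q.end_mem_support).2⟩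
          · exact ⟨by simp, Ne.symm hva⟩
      · exact Or.inr ⟨q, fun t ht => ⟨by simp [(hq t ht).1], (hq t ht).2⟩⟩

/-- If the deleted vertex lies on the ear, each remaining ear vertex still reaches an end, whose
attachment in `B` survives. If not, the ear is intact and at least one of `b ≠ b'` survives. -/
theorem IsRobust.union_ear {G : SimpleGraph V} {B : Set V} (hB : IsRobust G B) {x y b b' : V}
    (p : G.Walk x y) (hp : p.IsPath) (hpB : ∀ z ∈ p.support, z ∉ B) (hb : b ∈ B) (hb' : b' ∈ B)
    (hne : b ≠ b') (hbx : G.Adj b x) (hyb : G.Adj y b') :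
    IsRobust G (B ∪ {z | z ∈ p.support}) := by
  classical
  intro v
  have hto : ∀ z ∈ B ∪ {z | z ∈ p.support}, z ≠ v → ∃ k ∈ B, k ≠ v ∧
      ∃ q : G.Walk z k, ∀ t ∈ q.support, t ∈ B ∪ {z | z ∈ p.support} ∧ t ≠ v := by
    rintro z (hz | hz) hzv
    · exact ⟨z, hz, hzv, Walk.nil, by simpa using ⟨Or.inl hz, hzv⟩⟩
    have hz : z ∈ p.support := hz
    have hx : b ≠ v → (∃ q : G.Walk z x, ∀ t ∈ q.support, t ∈ p.support ∧ t ≠ v) →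
        ∃ k ∈ B, k ≠ v ∧
          ∃ q : G.Walk z k, ∀ t ∈ q.support, t ∈ B ∪ {z | z ∈ p.support} ∧ t ≠ v := by
      rintro hbv ⟨q, hq⟩
      refine ⟨b, hb, hbv, q.concat hbx.symm, fun t ht => ?_⟩
      rw [Walk.support_concat, List.mem_append, List.mem_singleton] at ht
      rcases ht with ht | rfl
      · exact ⟨Or.inr (hq t ht).1, (hq t ht).2⟩
      · exact ⟨Or.inl hb, hbv⟩
    have hy : b' ≠ v → (∃ q : G.Walk z y, ∀ t ∈ q.support, t ∈ p.support ∧ t ≠ v) →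
        ∃ k ∈ B, k ≠ v ∧
          ∃ q : G.Walk z k, ∀ t ∈ q.support, t ∈ B ∪ {z | z ∈ p.support} ∧ t ≠ v := by
      rintro hbv ⟨q, hq⟩
      refine ⟨b', hb', hbv, q.concat hyb, fun t ht => ?_⟩
      rw [Walk.support_concat, List.mem_append, List.mem_singleton] at ht
      rcases ht with ht | rfl
      · exact ⟨Or.inr (hq t ht).1, (hq t ht).2⟩
      · exact ⟨Or.inl hb', hbv⟩
    by_cases hv : v ∈ p.support
    · rcases exists_walk_avoiding p hp v z hz hzv with h | h
      · exact hx (fun h => hpB v hv (h ▸ hb)) h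
      · exact hy (fun h => hpB v hv (h ▸ hb')) h
    · by_cases hbv : b = v
      · refine hy (fun h => hne (hbv.trans h.symm)) ⟨p.dropUntil z hz, fun t ht => ?_⟩
        have ht' := p.support_dropUntil_subset_support hz ht
        exact ⟨ht', fun h => hv (h ▸ ht')⟩
      · refine hx hbv ⟨(p.takeUntil z hz).reverse, fun t ht => ?_⟩
        rw [Walk.support_reverse, List.mem_reverse] at ht
        have ht' := p.support_takeUntil_subset_support hz ht
        exact ⟨ht', fun h => hv (h ▸ ht')⟩
  intro s hs t ht hsv htv
  obtain ⟨k, hk, hkv, q, hq⟩ := hto s hs hsv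
  obtain ⟨k', hk', hkv', q', hq'⟩ := hto t ht htv
  obtain ⟨o, ho⟩ := hB v k hk k' hk' hkv hkv'
  refine ⟨q.append (o.append q'.reverse), fun z hz => ?_⟩
  rw [Walk.mem_support_append_iff, Walk.mem_support_append_iff, Walk.support_reverse,
    List.mem_reverse] at hz
  rcases hz with hz | hz | hz
  · exact hq z hz
  · exact ⟨Or.inl (ho z hz).1, (ho z hz).2⟩
  · exact hq' z hz

theorem IsRobust.insert {G : SimpleGraph V} {B : Set V} (hB : IsRobust G B) {u b b' : V}
    (hu : u ∉ B) (hb : b ∈ B) (hb' : b' ∈ B) (hne : b ≠ b') (h : G.Adj u b) (h' : G.Adj u b') :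
    IsRobust G (insert u B) := by
  have := hB.union_ear (Walk.nil : G.Walk u u) Walk.IsPath.nil (by simpa using hu) hb hb' hne
    h.symm h'
  convert this using 1
  ext z
  simp [or_comm]

/-- The graph on the same vertex set with only the edges of `G` that avoid `B`. -/
def avoidGraph (G : SimpleGraph V) (B : Set V) : SimpleGraph V where
  Adj a b := G.Adj a b ∧ a ∉ B ∧ b ∉ B
  symm := ⟨fun _ _ h => ⟨h.1.symm, h.2.2, h.2.1⟩⟩
  loopless := ⟨fun _ h => G.irrefl h.1⟩

theorem avoidGraph_le (G : SimpleGraph V) (B : Set V) : avoidGraph G B ≤ G := fun _ _ h => h.1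

theorem notMem_of_mem_support_avoidGraph {G : SimpleGraph V} {B : Set V} {x y : V}
    (p : (avoidGraph G B).Walk x y) (hx : x ∉ B) : ∀ z ∈ p.support, z ∉ B := by
  induction p with
  | nil => simpa using hx
  | cons h p ih => simpa using ⟨hx, ih h.2.2⟩

theorem exists_first_entry {G : SimpleGraph V} {B : Set V} {h e : V} (p : G.Walk h e)
    (hh : h ∉ B) (he : e ∈ B) :
    ∃ y b, b ∈ B ∧ b ∈ p.support ∧ y ∉ B ∧ G.Adj y b ∧ Nonempty ((avoidGraph G B).Walk h y) := by
  induction p with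
  | nil => exact absurd he hh
  | @cons a b c hab p ih =>
    by_cases hb : b ∈ B
    · exact ⟨a, b, hb, by simp, hh, hab, ⟨Walk.nil⟩⟩
    · obtain ⟨y, b', h1, h2, h3, h4, ⟨q⟩⟩ := ih hb he
      exact ⟨y, b', h1, by simp [h2], h3, h4, ⟨Walk.cons ⟨hab, hh, hb⟩ q⟩⟩

/-- There is a path outside `B` with `n` edges whose ends are attached to distinct vertices
of `B`. -/
def HasEar (G : SimpleGraph V) (B : Set V) (n : ℕ) : Prop :=
  ∃ x y b b', x ∉ B ∧ y ∉ B ∧ b ∈ B ∧ b' ∈ B ∧ b ≠ b' ∧ G.Adj b x ∧ G.Adj y b' ∧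
    ∃ p : (avoidGraph G B).Walk x y, p.length = n

/-- From an outside vertex `x` adjacent to `b`, a walk that avoids `b` must enter `B` at a different
vertex. -/
theorem exists_hasEar {G : SimpleGraph V} (hG : IsRobust G Set.univ) {B : Set V} {e e' h : V}
    (he : e ∈ B) (he' : e' ∈ B) (hne : e ≠ e') (hh : h ∉ B) : ∃ n, HasEar G B n := by
  obtain ⟨p, -⟩ := hG e' h trivial e trivial (fun hq => hh (hq ▸ he')) hne
  obtain ⟨x, b, hb, -, hx, hxb, -⟩ := exists_first_entry p hh he
  obtain ⟨d, hd, hdb⟩ : ∃ d ∈ B, d ≠ b := by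
    by_cases h : e = b
    · exact ⟨e', he', fun h' => hne (h.trans h'.symm)⟩
    · exact ⟨e, he, h⟩
  obtain ⟨q, hq⟩ := hG b x trivial d trivial hxb.ne hdb
  obtain ⟨y, b', hb', hbq, hy, hyb, ⟨w⟩⟩ := exists_first_entry q hx hd
  exact ⟨_, x, y, b, b', hx, hy, hb, hb', (hq b' hbq).2.symm, hxb.symm, hyb, w, rfl⟩

/-- For a shortest ear, a vertex off `B` and the ear has at most three neighbours in their union, so
it keeps `m - 1` of its `m + 2`. -/
theorem exists_ear_of_card_neighbors_le_one [Fintype V] [DecidableEq V] {G : SimpleGraph V}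
    [DecidableRel G.Adj] (hG : IsRobust G Set.univ) {m : ℕ} (hm : 1 ≤ m)
    (hdeg : ∀ v, m + 2 ≤ (Finset.univ.filter (G.Adj v)).card) {B : Finset V}
    (hB : IsRobust G (B : Set V)) {e e' h : V} (he : e ∈ B) (he' : e' ∈ B) (hne : e ≠ e')
    (hh : h ∉ B) (hone : ∀ w ∉ B, (B.filter (G.Adj w)).card ≤ 1) :
    ∃ Q : Finset V, Q.Nonempty ∧ Disjoint B Q ∧ IsRobust G ((B ∪ Q : Finset V) : Set V) ∧
      ((B ∪ Q)ᶜ).Nonempty ∧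
      ∀ w ∈ (B ∪ Q)ᶜ, m ≤ ((B ∪ Q)ᶜ.filter (G.Adj w)).card + 1 := by
  classical
  have hex := exists_hasEar hG (B := (B : Set V)) (by simpa using he) (by simpa using he') hne
    (by simpa using hh)
  set K := avoidGraph G (B : Set V) with hK
  set n := Nat.find hex with hn
  obtain ⟨x, y, b, b', hx, hy, hb, hb', hbb, hbx, hyb, (p : K.Walk x y),
    (hpn : p.length = n)⟩ := Nat.find_spec hex
  -- Reachability must be assumed because `dist` is `0` between different components.
  have hmin : ∀ x y b b', x ∉ B → y ∉ B → b ∈ B → b' ∈ B → b ≠ b' → G.Adj b x → G.Adj y b' →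
      K.Reachable x y → n ≤ K.dist x y := by
    intro x y b b' h1 h2 h3 h4 h5 h6 h7 h8
    obtain ⟨q, hq⟩ := h8.exists_walk_length_eq_dist
    exact Nat.find_min' hex ⟨x, y, b, b', by simpa using h1, by simpa using h2, by simpa using h3,
      by simpa using h4, h5, h6, h7, q, hq⟩
  have hdist : p.length = K.dist x y :=
    le_antisymm (hpn.trans_le (hmin x y b b' (by simpa using hx) (by simpa using hy)
      (by simpa using hb) (by simpa using hb') hbb hbx hyb p.reachable)) (dist_le p)
  have hpath := p.isPath_of_length_eq_dist hdist
  have hpB := notMem_of_mem_support_avoidGraph p hx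
  have hsum : ∀ z (hz : z ∈ p.support), K.dist x z + K.dist z y = n ∧
      (p.takeUntil z hz).length = K.dist x z := by
    intro z hz
    have h1 := congrArg Walk.length (p.take_spec hz)
    rw [Walk.length_append] at h1
    have h2 := dist_le (p.takeUntil z hz)
    have h3 := dist_le (p.dropUntil z hz)
    have h4 := (p.takeUntil z hz).reachable.dist_triangle_left y
    omega
  have hinj : Set.InjOn (K.dist x) {z | z ∈ p.support} := by
    intro z hz z' hz' h
    have h1 := (hsum z hz).2
    have h2 := (hsum z' hz').2
    rw [← p.getVert_length_takeUntil hz, ← p.getVert_length_takeUntil hz', h1, h2]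
    exact congrArg _ h
  set Q := p.support.toFinset with hQ
  have hQB : ∀ z ∈ Q, z ∉ B := fun z hz => by simpa using hpB z (by simpa [hQ] using hz)
  -- Distance from `x` is injective on a shortest path, so neighbours on the ear are counted by the
  -- distances they can have.
  have hcardQ : ∀ (w : V) (I : Finset ℕ), (∀ z ∈ Q, G.Adj w z → K.dist x z ∈ I) →
      (Q.filter (G.Adj w)).card ≤ I.card := by
    intro w I hI
    refine Finset.card_le_card_of_injOn (K.dist x) ?_ (hinj.mono ?_)
    · intro z hz
      rw [Finset.mem_coe, Finset.mem_filter] at hz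
      exact hI z hz.1 hz.2
    · intro z hz
      rw [Finset.mem_coe, Finset.mem_filter, hQ, List.mem_toFinset] at hz
      exact hz.1
  have hsplit : ∀ w, m + 2 ≤ (B.filter (G.Adj w)).card + (Q.filter (G.Adj w)).card +
      ((B ∪ Q)ᶜ.filter (G.Adj w)).card := by
    intro w
    refine (hdeg w).trans ?_
    rw [← Finset.union_compl (B ∪ Q), Finset.filter_union, Finset.filter_union]
    exact (Finset.card_union_le _ _).trans (Nat.add_le_add_right (Finset.card_union_le _ _) _)
  have hxQ : x ∈ Q := by simp [hQ]
  refine ⟨Q, ⟨x, hxQ⟩, Finset.disjoint_right.2 hQB, ?_, ?_, ?_⟩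
  · have := hB.union_ear (p.mapLe (avoidGraph_le G _)) (hpath.mapLe _) (by simpa using hpB)
      hb hb' hbb hbx hyb
    convert this using 1
    ext z
    simp [hQ]
  · have h1 := hsplit x
    have h2 := hone x (by simpa using hx)
    have h3 := hcardQ x {1} (by
      intro z hz hxz
      rw [Finset.mem_singleton, dist_eq_one_iff_adj]
      exact ⟨hxz, hx, by simpa using hQB z hz⟩)
    rw [Finset.card_singleton] at h3
    have h4 : 0 < ((B ∪ Q)ᶜ.filter (G.Adj x)).card := by omega
    obtain ⟨z, hz⟩ := Finset.card_pos.1 h4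
    exact ⟨z, (Finset.mem_filter.1 hz).1⟩
  · intro w hw
    rw [Finset.mem_compl, Finset.mem_union, not_or] at hw
    have hadj : ∀ z ∈ Q, G.Adj w z → K.Adj z w := fun z hz h =>
      ⟨h.symm, by simpa using hQB z hz, by simpa using hw.1⟩
    have hd : ∀ z ∈ Q, G.Adj w z → K.dist x w ≤ K.dist x z + 1 ∧ K.dist x z ≤ K.dist x w + 1 ∧
        K.dist w y ≤ K.dist z y + 1 ∧ K.dist x z + K.dist z y = n ∧
        K.Reachable x w ∧ K.Reachable w y := by
      intro z hz h
      have hzs : z ∈ p.support := by simpa [hQ] using hz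
      have hzw := hadj z hz h
      have h1 := dist_eq_one_iff_adj.2 hzw
      have h1' := dist_eq_one_iff_adj.2 hzw.symm
      have h2 := hzw.reachable.dist_triangle_right x
      have h3 := hzw.symm.reachable.dist_triangle_right x
      have h4 := hzw.symm.reachable.dist_triangle_left y
      exact ⟨by omega, by omega, by omega, (hsum z hzs).1,
        (p.takeUntil z hzs).reachable.trans hzw.reachable,
        hzw.symm.reachable.trans (p.dropUntil z hzs).reachable⟩
    have h1 := hsplit w
    have h2 := hone w hw.1
    rcases (B.filter (G.Adj w)).eq_empty_or_nonempty with h0 | ⟨β, hβ⟩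
    · have h3 := hcardQ w (Finset.Icc (K.dist x w - 1) (K.dist x w + 1)) (by
        intro z hz hwz
        have := hd z hz hwz
        rw [Finset.mem_Icc]
        omega)
      rw [Nat.card_Icc] at h3
      rw [h0, Finset.card_empty] at h1
      omega
    · rw [Finset.mem_filter] at hβ
      -- As `b ≠ b'`, the neighbour `β` differs from one of them and closes a competing ear through
      -- `w`. Minimality pushes the neighbours of `w` on `Q` to within distance one of an end.
      have h3 : (Q.filter (G.Adj w)).card ≤ 2 := by
        by_cases hbβ : b = β
        · refine (hcardQ w (Finset.Icc 0 1) ?_).trans (by simp)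
          intro z hz hwz
          obtain ⟨d1, d2, d3, d4, d5, d6⟩ := hd z hz hwz
          have := hmin w y b b' hw.1 (by simpa using hy) (by simpa using hb) (by simpa using hb')
            hbb (hbβ ▸ hβ.2.symm) hyb d6
          rw [Finset.mem_Icc]
          omega
        · refine (hcardQ w (Finset.Icc (n - 1) n) ?_).trans (by rw [Nat.card_Icc]; omega)
          intro z hz hwz
          obtain ⟨d1, d2, d3, d4, d5, d6⟩ := hd z hz hwz
          have := hmin x w b β (by simpa using hx) hw.1 (by simpa using hb) hβ.1 hbβ hbx hβ.2 d5
          rw [Finset.mem_Icc]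
          omega
      omega

end Ears

/-! ### The extremal argument. -/

section Main

variable {V : Type*}

theorem IsKConnected.isRobust [Finite V] {G : SimpleGraph V} (hG : IsKConnected 2 G) :
    IsRobust G Set.univ := by
  intro v a _ b _ hav hbv
  have h := hG.2 {v} (by simp)
  obtain ⟨p⟩ := h.preconnected ⟨a, by simpa using hav⟩ ⟨b, by simpa using hbv⟩
  refine ⟨p.map (Embedding.induce _).toHom, fun z hz => ⟨trivial, ?_⟩⟩
  have hz' : z ∈ p.support.map (Embedding.induce _).toHom :=
    (congrArg (z ∈ ·) (Walk.support_map (Embedding.induce _).toHom p)).mp hz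
  obtain ⟨z, -, rfl⟩ := List.mem_map.1 hz'
  simpa using z.2

theorem IsRobust.isKConnected [Finite V] {G : SimpleGraph V} {A : Set V} (hA : IsRobust G A)
    (hcard : 2 < Nat.card A) : IsKConnected 2 (G.induce A) := by
  classical
  refine ⟨hcard, fun X hX => ?_⟩
  have hfin := Fintype.ofFinite A
  have hcompl : ∃ a, a ∉ X := by
    by_contra! h
    have h1 : X = Finset.univ := Finset.eq_univ_of_forall h
    rw [h1, Finset.card_univ, ← Nat.card_eq_fintype_card] at hX
    omega
  obtain ⟨e, he⟩ := hcompl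
  have hpre : ∀ v : V, (∀ w ∈ X, w.1 = v) → ∀ a b : A, a ∉ X → b ∉ X → a.1 ≠ v → b.1 ≠ v →
      ∃ p : (G.induce A).Walk a b, ∀ z ∈ p.support, z ∉ X := by
    intro v hv a b ha hb hav hbv
    obtain ⟨p, hp⟩ := hA v a a.2 b b.2 hav hbv
    refine ⟨p.induce A fun z hz => (hp z hz).1, fun z hz hzX => ?_⟩
    have h1 : z.1 ∈ p.support := by
      rw [Walk.support_induce] at hz
      exact (List.mem_attachWith ..).1 hz
    exact (hp z.1 h1).2 (hv z hzX)
  have hwalk : ∀ a b : A, a ∉ X → b ∉ X →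
      ∃ p : (G.induce A).Walk a b, ∀ z ∈ p.support, z ∉ X := by
    intro a b ha hb
    rcases X.eq_empty_or_nonempty with rfl | ⟨w, hw⟩
    -- With nothing deleted, robustness is applied to a third vertex of `A`, which exists by
    -- cardinality.
    · obtain ⟨v, hv⟩ : ∃ v : A, v ∉ ({a, b} : Finset A) := by
        by_contra! h
        have h1 : ({a, b} : Finset A) = Finset.univ := Finset.eq_univ_of_forall h
        have h2 := Finset.card_le_two (a := a) (b := b)
        rw [h1, Finset.card_univ, ← Nat.card_eq_fintype_card] at h2
        omega
      simp only [Finset.mem_insert, Finset.mem_singleton, not_or] at hv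
      exact hpre v (by simp) a b ha hb (fun h => hv.1 (Subtype.ext h.symm))
        (fun h => hv.2 (Subtype.ext h.symm))
    · have hall : ∀ z ∈ X, z = w := fun z hz =>
        Finset.card_le_one.1 (by omega) z hz w hw
      exact hpre w (fun z hz => congrArg _ (hall z hz)) a b ha hb
        (fun h => ha (by rwa [Subtype.ext h])) (fun h => hb (by rwa [Subtype.ext h]))
  have : Nonempty ((X : Set A)ᶜ : Set A) := ⟨⟨e, by simpa using he⟩⟩
  refine ⟨fun a b => ?_⟩
  obtain ⟨p, hp⟩ := hwalk a b (fun h => a.2 h) (fun h => b.2 h)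
  exact ⟨p.induce _ fun z hz => by simpa using hp z hz⟩

/-- A largest admissible `B` leaves exactly the vertices of a copy. The starting set is an edge,
which costs every other vertex at most two neighbours. -/
theorem exists_robust_compl_copy [Fintype V] [DecidableEq V] {W : Type*} [Fintype W]
    {S : SimpleGraph W} {c c' x y : W} (hS : IsFrame S c c' x y) {G : SimpleGraph V}
    [DecidableRel G.Adj] {r m : ℕ} (hm : Fintype.card W + r = m) (hrm : r + 4 ≤ m)
    (hG : IsRobust G Set.univ) [Nonempty V]
    (hdeg : ∀ v, m + 2 ≤ (Finset.univ.filter (G.Adj v)).card) :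
    ∃ f : Copy (attachPath S x r) G, IsRobust G (Set.range f)ᶜ := by
  classical
  let P : Finset V → Prop := fun B => 2 ≤ B.card ∧ IsRobust G (B : Set V) ∧
    HasCopyIn (attachPath S x r) G Bᶜ
  have hdegB : ∀ (B : Finset V) (v : V), m + 2 ≤ (B.filter (G.Adj v)).card +
      (Bᶜ.filter (G.Adj v)).card := by
    intro B v
    refine (hdeg v).trans ?_
    rw [← Finset.union_compl B, Finset.filter_union]
    exact Finset.card_union_le _ _
  have hstart : ∃ B, P B := by
    obtain ⟨a⟩ := ‹Nonempty V›
    have ha := hdeg a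
    obtain ⟨b, hb⟩ := Finset.card_pos.1 (show 0 < (Finset.univ.filter (G.Adj a)).card by omega)
    have hab : G.Adj a b := (Finset.mem_filter.1 hb).2
    have h2 : ({a, b} : Finset V).card = 2 := Finset.card_pair hab.ne
    refine ⟨{a, b}, h2.ge, ?_, hasCopyIn_of_minDegree hS hm (by omega) _ ?_ ?_⟩
    · intro v s hs t ht hsv htv
      by_cases hst : G.Adj s t
      · exact ⟨hst.toWalk, by
          intro z hz
          simp only [Walk.support_cons, Walk.support_nil, List.mem_cons, List.not_mem_nil,
            or_false] at hz
          rcases hz with rfl | rfl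
          · exact ⟨hs, hsv⟩
          · exact ⟨ht, htv⟩⟩
      · have : s = t := by
          simp only [Finset.coe_insert, Finset.coe_singleton, Set.mem_insert_iff,
            Set.mem_singleton_iff] at hs ht
          rcases hs with rfl | rfl <;> rcases ht with rfl | rfl
          · rfl
          · exact absurd hab hst
          · exact absurd hab.symm hst
          · rfl
        subst this
        exact ⟨Walk.nil, by simpa using ⟨by simpa using hs, hsv⟩⟩
    · have h1 := hdegB {a, b} a
      have h3 := Finset.card_filter_le ({a, b} : Finset V) (G.Adj a)
      have h4 := Finset.card_filter_le ({a, b} : Finset V)ᶜ (G.Adj a)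
      rw [← Finset.card_pos]
      omega
    · intro w _
      have h1 := hdegB {a, b} w
      have h3 := Finset.card_filter_le ({a, b} : Finset V) (G.Adj w)
      omega
  obtain ⟨B, hBP, hmax⟩ : ∃ B, P B ∧ ∀ B', P B' → B'.card ≤ B.card := by
    obtain ⟨B, hB, h⟩ := Finset.exists_max_image (Finset.univ.filter P) Finset.card (by
      obtain ⟨B, hB⟩ := hstart
      exact ⟨B, by simpa using hB⟩)
    exact ⟨B, by simpa using hB, fun B' hB' => h B' (by simpa using hB')⟩
  obtain ⟨hB2, hBR, hBC⟩ := hBP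
  obtain ⟨e, he, e', he', hee⟩ := Finset.one_lt_card.1 hB2
  obtain ⟨f, hf⟩ := hBC
  have finj : Function.Injective f := f.injective
  set M : Finset V := Finset.univ.image f with hM
  have hMcard : M.card = m := by
    rw [hM, Finset.card_image_of_injective _ finj, Finset.card_univ, Fintype.card_sum,
      Fintype.card_fin, hm]
  have hMB : M ⊆ Bᶜ := by
    intro v hv
    obtain ⟨z, -, rfl⟩ := Finset.mem_image.1 hv
    exact hf z
  rcases (Finset.card_le_card hMB).eq_or_lt with heq | hlt
  · refine ⟨f, ?_⟩
    have h1 : M = Bᶜ := Finset.eq_of_subset_of_card_le hMB heq.ge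
    have h2 : (Set.range f)ᶜ = (B : Set V) := by
      ext v
      have := congrArg (v ∈ ·) h1
      simp only [hM, Finset.mem_image, Finset.mem_univ, true_and, Finset.mem_compl, eq_iff_iff]
        at this
      rw [Set.mem_compl_iff, Set.mem_range, this, Finset.mem_coe, not_not]
    rw [h2]
    exact hBR
  · exfalso
    rw [hMcard] at hlt
    set U : Finset V := Bᶜ.filter fun h => 2 ≤ (B.filter (G.Adj h)).card with hU
    rcases U.eq_empty_or_nonempty with hUe | hUne
    · have hone : ∀ w ∉ B, (B.filter (G.Adj w)).card ≤ 1 := by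
        intro w hw
        by_contra h
        have : w ∈ U := by
          rw [hU, Finset.mem_filter, Finset.mem_compl]
          exact ⟨hw, by omega⟩
        rw [hUe] at this
        simp at this
      obtain ⟨h, hh⟩ := Finset.card_pos.1 (show 0 < Bᶜ.card by omega)
      obtain ⟨Q, hQne, hQB, hQR, hne, hQdeg⟩ := exists_ear_of_card_neighbors_le_one hG
        (by omega) hdeg hBR he he' hee (by simpa using hh) hone
      have h1 := Finset.card_union_of_disjoint hQB
      have h2 := hQne.card_pos
      have := hmax (B ∪ Q) ⟨by omega, hQR,
        hasCopyIn_of_minDegree hS hm (by omega) _ hne hQdeg⟩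
      omega
    · obtain ⟨u, hu, hcopy⟩ := exists_hasCopyIn_erase hS hm hrm Bᶜ U hUne (by
        intro w hw hwU
        have h1 := hdegB B w
        have h2 : ¬ 2 ≤ (B.filter (G.Adj w)).card := fun h =>
          hwU (Finset.mem_filter.2 ⟨hw, h⟩)
        omega) hlt ⟨f, hf⟩
      rw [hU, Finset.mem_filter, Finset.mem_compl] at hu
      obtain ⟨b, hb, b', hb', hbb⟩ := Finset.one_lt_card.1 hu.2
      rw [Finset.mem_filter] at hb hb'
      have hR : IsRobust G ((insert u B : Finset V) : Set V) := by
        rw [Finset.coe_insert]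
        exact hBR.insert (by simpa using hu.1) (by simpa using hb.1) (by simpa using hb'.1) hbb
          hb.2 hb'.2
      have h1 := Finset.card_insert_of_notMem hu.1
      have := hmax (insert u B) ⟨by omega, hR, by rwa [Finset.compl_insert]⟩
      omega

end Main

end PathDoubleStar

theorem theorem3p4 {V W : Type*} [Fintype V] [Fintype W] (r m : ℕ) (hr : 1 ≤ r) (hm : r + 4 ≤ m)
    (S : SimpleGraph W) [DecidableRel S.Adj] (hS : PathDoubleStar.IsDoubleStar S)
    (hcard : Fintype.card W = m - r)
    (G : SimpleGraph V) [DecidableRel G.Adj] (hG : PathDoubleStar.IsKConnected 2 G)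
    (hdeg : m + 2 ≤ G.minDegree) :
    ∃ T : G.Subgraph,
      (PathDoubleStar.IsPDS1 S r T.coe ∨ PathDoubleStar.IsPDS2 S r T.coe) ∧
        PathDoubleStar.IsKConnected 2 (G.induce T.vertsᶜ) := by
  classical
  obtain ⟨c, c', x, y, hF, hmax, hx⟩ := PathDoubleStar.exists_frame S hS
  have hne : Nonempty V := by
    have := hG.1
    exact (Nat.card_pos_iff.1 (by omega)).1
  have hmr : Fintype.card W + r = m := by omega
  have hdeg' : ∀ v, m + 2 ≤ (Finset.univ.filter (G.Adj v)).card := by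
    intro v
    have h1 := hdeg.trans (G.minDegree_le_degree v)
    rwa [← SimpleGraph.card_neighborFinset_eq_degree, SimpleGraph.neighborFinset_eq_filter] at h1
  obtain ⟨f, hf⟩ := PathDoubleStar.exists_robust_compl_copy hF hmr hm hG.isRobust hdeg'
  have hverts : f.toSubgraph.verts = Set.range f := by
    simp [SimpleGraph.Copy.toSubgraph]
  refine ⟨f.toSubgraph, Or.inl ⟨c, x, hmax, hx, hF.adj_x, ⟨f.isoToSubgraph.symm⟩⟩, ?_⟩
  rw [hverts]
  refine hf.isKConnected ?_
  have finj : Function.Injective f := f.injective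
  have h1 : Nat.card (Set.range f) = m := by
    rw [Nat.card_range_of_injective finj, Nat.card_eq_fintype_card, Fintype.card_sum,
      Fintype.card_fin, hmr]
  have h2 : Nat.card (Set.range f) + Nat.card ((Set.range f)ᶜ : Set V) = Nat.card V := by
    rw [Nat.card_coe_set_eq, Nat.card_coe_set_eq]
    exact Set.ncard_add_ncard_compl _
  -- A vertex of degree at least `m + 2` gives at least `m + 3` vertices in all, so at least three
  -- remain outside the tree.
  obtain ⟨v⟩ := hne
  have h3 := hdeg.trans (G.minDegree_le_degree v)
  have h4 := G.degree_lt_card_verts v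
  rw [← Nat.card_eq_fintype_card] at h4
  omega
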